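/- For a finite graph $G$ with vertex set $V$ and an integer $\ell\ge 1$, let $\mathsf{SA}_\ell(G)$ be the level-$\ell$ Sherali–Adams strengthening of the clique-constrained relaxation $\mathsf{QSTAB}(G)=\{x\in\mathbb R_{\ge 0}^{V}:\sum_{i\in Q}x_i\le 1\text{ for every clique }Q\}$ of the (unweighted) maximum independent set problem, that is, the linear program in variables $y_A$ ($A\subseteq V$) that maximizes $\sum_{i\in V}y_{\{i\}}$ subject to $y_\emptyset=1$ and, for all disjoint $S,T\subseteq V$ with $|S\cup T|\le \ell$, all cliques $Q$ of $G$ and all $i\in V$, $$\sum_{T'\subseteq T}(-1)^{|T'|}y_{S\cup T'}-\sum_{j\in Q}\sum_{T'\subseteq T}(-1)^{|T'|}y_{S\cup T'\cup\{j\}}\ge 0,\qquad \sum_{T'\subseteq T}(-1)^{|T'|}y_{S\cup T'}\ge 0,\qquad \sum_{T'\subseteq T}(-1)^{|T'|}y_{S\cup T'\cup\{i\}}\ge 0 .$$ Its integrality gap is its optimal value divided by the independence number $\alpha(G)$. A graph is $k$-claw-free if it has no induced subgraph isomorphic to $K_{1,k}$. There are absolute constants $c_1,c_2,c_3,c_4>0$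 such that the following holds. Let $f$ be a real-valued function with $f(k)=\Omega(k^3)$, i.e. for some $a>0$, $f(k)\ge a k^3$ for all integers $k\ge 4$. Then for every integer $k\ge 4$ there are infinitely many $n\in\mathbb N$ for which there is a $k$-claw-free graph $G_n$ with $c_1 n\le |V(G_n)|\le c_2 n$ and $\alpha(G_n)\ge k$ such that, for some integer $\ell\ge 1$ with $\ell\ge c_3\,n/f(k)$, the integrality gap of $\mathsf{SA}_\ell(G_n)$ is at least $c_4\,f(k)/k^2$. -/

import Mathlib

/-- `G` is `k`-claw-free: the star `K_{1,k}` is not an induced subgraph of `G`. -/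
def IsClawFree {V : Type*} (k : ℕ) (G : SimpleGraph V) : Prop :=
  ¬ (completeBipartiteGraph (Fin 1) (Fin k)).IsIndContained G

/-- The expression `∑_{T' ⊆ T} (-1)^{|T'|} y_{S ∪ T'}`. -/
noncomputable def juntaSum {V : Type*} [DecidableEq V] (y : Finset V → ℝ) (S T : Finset V) : ℝ :=
  ∑ T' ∈ T.powerset, (-1 : ℝ) ^ T'.card * y (S ∪ T')

/-- `y` is a feasible solution of the level-`ℓ` Sherali--Adams strengthening of
the clique linear program `QSTAB(G)`: maximize `∑ i, x i` subject to
`1 - ∑ i ∈ Q, x i ≥ 0` for every clique `Q` and `x i ≥ 0` for every vertex `i`. -/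
structure IsSAFeasible {V : Type*} [DecidableEq V] (G : SimpleGraph V) (ℓ : ℕ)
    (y : Finset V → ℝ) : Prop where
  clique : ∀ S T : Finset V, Disjoint S T → (S ∪ T).card ≤ ℓ →
    ∀ Q : Finset V, G.IsClique (Q : Set V) →
      0 ≤ juntaSum y S T -
        ∑ i ∈ Q, ∑ T' ∈ T.powerset, (-1 : ℝ) ^ T'.card * y (S ∪ T' ∪ {i})
  junta : ∀ S T : Finset V, Disjoint S T → (S ∪ T).card ≤ ℓ → 0 ≤ juntaSum y S T
  juntaVar : ∀ S T : Finset V, Disjoint S T → (S ∪ T).card ≤ ℓ → ∀ i : V,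
    0 ≤ ∑ T' ∈ T.powerset, (-1 : ℝ) ^ T'.card * y (S ∪ T' ∪ {i})
  empty : y ∅ = 1

/-- The objective values of the feasible solutions at level `ℓ`. -/
def saValues {V : Type*} [Fintype V] [DecidableEq V] (G : SimpleGraph V) (ℓ : ℕ) : Set ℝ :=
  {v | ∃ y : Finset V → ℝ, IsSAFeasible G ℓ y ∧ v = ∑ i, y {i}}

/-- The set of objective values is nonempty, so its supremum is meaningful. -/
theorem saValues_nonempty {V : Type*} [Fintype V] [DecidableEq V] (G : SimpleGraph V) (ℓ : ℕ) :
    (saValues G ℓ).Nonempty := by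
  refine ⟨_, fun A => if A = ∅ then 1 else 0, ?_, rfl⟩
  have key : ∀ S T : Finset V,
      0 ≤ juntaSum (fun A : Finset V => if A = ∅ then (1 : ℝ) else 0) S T := by
    intro S T
    refine Finset.sum_nonneg fun T' _ => ?_
    by_cases h : T' = ∅
    · subst h
      by_cases hS : S = ∅ <;> simp [hS]
    · simp [Finset.union_eq_empty, h]
  refine ⟨fun S T _ _ Q _ => ?_, fun S T _ _ => key S T, fun S T _ _ i => ?_, by simp⟩
  · have := key S T
    simpa [Finset.union_eq_empty] using this
  · simp [Finset.union_eq_empty]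

/-- The set of objective values is bounded above, so its supremum is meaningful. -/
theorem saValues_bddAbove {V : Type*} [Fintype V] [DecidableEq V] (G : SimpleGraph V) (ℓ : ℕ) :
    BddAbove (saValues G ℓ) := by
  refine ⟨∑ _i : V, (1 : ℝ), ?_⟩
  rintro v ⟨y, hy, rfl⟩
  refine Finset.sum_le_sum fun i _ => ?_
  have := hy.clique ∅ ∅ (by simp) (by simp) {i} (by simp)
  simp [juntaSum, hy.empty] at this
  linarith

/-- The integrality gap of the level-`ℓ` Sherali--Adams strengthening of `QSTAB(G)`:
its optimal value divided by the independence number of `G`. -/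
noncomputable def saIntegralityGap {V : Type*} [Fintype V] [DecidableEq V]
    (G : SimpleGraph V) (ℓ : ℕ) : ℝ :=
  sSup (saValues G ℓ) / (G.indepNum : ℝ)

/-!
For a real number `x ≥ 0`, let `y` assign `1` to `∅`, `x` to every singleton and `0` to every larger
set. These are the pseudo-moments of "choose at most one vertex, each vertex with weight `x`".
Every Sherali–Adams constraint is a pseudo-expectation of a product of a junta and a linear form,
and for this `y` all constraints follow from `(ℓ + |Q|) x ≤ 1` for all cliques `Q`
(`isSAFeasible_singletonMoments`). Hence a graph with `N` vertices all of whose cliques are small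
compared with `N / F` has level-`N / F` value of order `F`, however small its independence number.

It remains to find a `k`-claw-free graph with independence number of order `k` and clique number
`o(N)`. Over a finite field with `q` elements, join two points `(a, b)`, `(c, d)` of the plane when
`b + d = a c`. Two points have at most one common neighbour, so this graph has no `K₄`
(`polarityGraph_cliqueFree_four`), and a second-moment count of incidences shows that its
independent sets have at most `2 q ^ (3 / 2)` of the `q ^ 2` points
(`card_sq_le_of_isIndepSet_polarityGraph`). The complement therefore has independence number at most
`3` and clique number `o(q ^ 2)`. The union of `k` disjoint copies of it has independence
number between `k` and `3 k`, and contains no induced `K_{1,k}` since `k ≥ 4`: all the leaves would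
lie in one copy. For `k` and `F = f k` fixed, the cliques are smaller than `N / F` once `q` is large.
-/

open Finset

/-! ### Sherali–Adams solutions supported on singletons -/

/-- The pseudo-moments `y_A` of the signed measure giving weight `x` to the indicator vector of each
singleton and the remaining weight `1 - |V| x` to the zero vector: `1` at `∅`, `x` at singletons and
`0` elsewhere. Written as a combination of the moments of point masses, because the alternating sums
of the latter are again indicators. -/
noncomputable def singletonMoments {V : Type*} [Fintype V] [DecidableEq V] (x : ℝ)
    (A : Finset V) : ℝ :=
  (1 - Fintype.card V * x) * (if A ⊆ ∅ then 1 else 0) + x * ∑ v, if A ⊆ {v} then 1 else 0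

/-- Inclusion–exclusion for the moments `A ↦ [A ⊆ B]` of the indicator vector of `B`: the junta
`∏_{i ∈ S} X_i ∏_{i ∈ T} (1 - X_i)` evaluates at that vector to `[S ⊆ B ∧ T ∩ B = ∅]`. -/
theorem sum_powerset_neg_one_pow_mul_subset {V : Type*} [DecidableEq V] (S T B : Finset V) :
    ∑ T' ∈ T.powerset, (-1 : ℝ) ^ T'.card * (if S ∪ T' ⊆ B then 1 else 0) =
      if S ⊆ B ∧ Disjoint T B then 1 else 0 := by
  have h1 : ∑ T' ∈ T.powerset, (-1 : ℝ) ^ T'.card * (if T' ⊆ B then 1 else 0) =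
      ∏ i ∈ T, (1 + if i ∈ B then (-1 : ℝ) else 0) := by
    rw [Finset.prod_one_add]
    refine Finset.sum_congr rfl fun T' _ => ?_
    rw [Finset.prod_ite_zero]
    simp [Finset.subset_iff]
  have h2 : ∏ i ∈ T, (1 + if i ∈ B then (-1 : ℝ) else 0) = if Disjoint T B then 1 else 0 := by
    have : ∀ i ∈ T, (1 + if i ∈ B then (-1 : ℝ) else 0) = if i ∉ B then 1 else 0 := by
      intro i _
      by_cases h : i ∈ B <;> simp [h]
    rw [Finset.prod_congr rfl this, Finset.prod_ite_zero]
    simp [Finset.disjoint_left]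
  by_cases hS : S ⊆ B
  · simpa [Finset.union_subset_iff, hS] using h1.trans h2
  · simp [Finset.union_subset_iff, hS]

section
variable {V : Type*} [Fintype V] [DecidableEq V]

theorem juntaSum_singletonMoments (x : ℝ) (S T : Finset V) :
    juntaSum (singletonMoments x) S T =
      (1 - Fintype.card V * x) * (if S = ∅ then 1 else 0) +
        x * ((univ.filter fun v => S ⊆ {v} ∧ v ∉ T).card : ℝ) := by
  have h0 := sum_powerset_neg_one_pow_mul_subset S T ∅
  have h1 := fun v : V => sum_powerset_neg_one_pow_mul_subset S T {v}
  simp only [Finset.subset_empty, Finset.disjoint_empty_right, and_true,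
    Finset.disjoint_singleton_right] at h0 h1
  unfold juntaSum singletonMoments
  rw [← h0, Finset.card_filter]
  push_cast
  simp_rw [← h1]
  rw [Finset.sum_comm, Finset.mul_sum, Finset.mul_sum, ← Finset.sum_add_distrib]
  refine Finset.sum_congr rfl fun T' _ => ?_
  rw [← Finset.mul_sum]
  simp only [Finset.subset_empty]
  ring

theorem singletonMoments_singleton (x : ℝ) (i : V) : singletonMoments x {i} = x := by
  simp [singletonMoments]

theorem sum_powerset_singletonMoments_insert (x : ℝ) (S T : Finset V) (i : V) :
    ∑ T' ∈ T.powerset, (-1 : ℝ) ^ T'.card * singletonMoments x (S ∪ T' ∪ {i}) =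
      x * if S ⊆ {i} ∧ i ∉ T then 1 else 0 := by
  have h := juntaSum_singletonMoments x (S ∪ {i}) T
  unfold juntaSum at h
  simp_rw [Finset.union_right_comm S _ {i}]
  have hne : S ∪ {i} ≠ ∅ := fun h => by simpa [h] using (by simp : i ∈ S ∪ {i})
  rw [h, if_neg hne, mul_zero, zero_add]
  congr 1
  have hmem : ∀ v, S ∪ {i} ⊆ {v} ∧ v ∉ T ↔ v = i ∧ S ⊆ {i} ∧ i ∉ T := by
    intro v
    rw [Finset.union_subset_iff, Finset.singleton_subset_singleton]
    constructor
    · rintro ⟨⟨h, rfl⟩, hT⟩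
      exact ⟨rfl, h, hT⟩
    · rintro ⟨rfl, h, hT⟩
      exact ⟨⟨h, rfl⟩, hT⟩
  simp_rw [hmem]
  by_cases h : S ⊆ {i} ∧ i ∉ T
  · simp only [h, and_true, not_false_eq_true, Finset.filter_eq', Finset.mem_univ, if_true,
      Finset.card_singleton, Nat.cast_one]
  · simp only [h, and_false, Finset.filter_false, Finset.card_empty, Nat.cast_zero, if_false]

theorem isSAFeasible_singletonMoments (G : SimpleGraph V) (ℓ : ℕ) {x : ℝ} (hx : 0 ≤ x)
    (hQ : ∀ Q : Finset V, G.IsClique (Q : Set V) → ((ℓ : ℝ) + Q.card) * x ≤ 1) :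
    IsSAFeasible G ℓ (singletonMoments x) := by
  have hclique : ∀ S T : Finset V, Disjoint S T → (S ∪ T).card ≤ ℓ →
      ∀ Q : Finset V, G.IsClique (Q : Set V) →
        0 ≤ juntaSum (singletonMoments x) S T -
          ∑ i ∈ Q, ∑ T' ∈ T.powerset, (-1 : ℝ) ^ T'.card * singletonMoments x (S ∪ T' ∪ {i}) := by
    intro S T _ hcard Q hcl
    simp_rw [sum_powerset_singletonMoments_insert]
    rw [juntaSum_singletonMoments, ← Finset.mul_sum, Finset.sum_boole]
    rcases S.eq_empty_or_nonempty with rfl | hS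
    · have h1 : ((univ.filter fun v => v ∉ T).card : ℝ) = Fintype.card V - T.card := by
        rw [eq_sub_iff_add_eq]
        have := Finset.card_filter_add_card_filter_not (s := (univ : Finset V)) (fun v => v ∈ T)
        simp only [Finset.filter_univ_mem, Finset.card_univ] at this
        exact_mod_cast (add_comm _ _).trans this
      have h2 : ((Q.filter fun v => v ∉ T).card : ℝ) ≤ Q.card := by
        exact_mod_cast Finset.card_filter_le _ _
      have h3 : (T.card : ℝ) ≤ ℓ := by simpa using hcard
      simp only [Finset.empty_subset, true_and, if_true, mul_one, h1]
      nlinarith [hQ Q hcl, mul_le_mul_of_nonneg_left h2 hx, mul_le_mul_of_nonneg_left h3 hx]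
    · rw [if_neg hS.ne_empty, mul_zero, zero_add, ← mul_sub]
      refine mul_nonneg hx (sub_nonneg.2 ?_)
      exact_mod_cast Finset.card_le_card (Finset.filter_subset_filter _ (Finset.subset_univ Q))
  refine ⟨hclique, fun S T hd hcard => ?_, fun S T _ _ i => ?_, ?_⟩
  · simpa using hclique S T hd hcard ∅ (by simp)
  · rw [sum_powerset_singletonMoments_insert]
    positivity
  · simp [singletonMoments, mul_comm x]

theorem mul_card_div_indepNum_le_saIntegralityGap (G : SimpleGraph V) (ℓ : ℕ) {x : ℝ} (hx : 0 ≤ x)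
    (hQ : ∀ Q : Finset V, G.IsClique (Q : Set V) → ((ℓ : ℝ) + Q.card) * x ≤ 1) :
    Fintype.card V * x / (G.indepNum : ℝ) ≤ saIntegralityGap G ℓ := by
  refine div_le_div_of_nonneg_right (le_csSup (saValues_bddAbove G ℓ) ?_) (Nat.cast_nonneg _)
  exact ⟨_, isSAFeasible_singletonMoments G ℓ hx hQ, by simp [singletonMoments_singleton]⟩

end

/-! ### The polarity graph of an affine plane -/

/-- The graph on the affine plane `K²` joining distinct points `(a, b)` and `(c, d)` when
`b + d = a c`. -/
def polarityGraph (K : Type*) [Field K] : SimpleGraph (K × K) :=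
  .mk (fun x y => x ≠ y ∧ x.2 + y.2 = x.1 * y.1)
    ⟨fun x y h => ⟨h.1.symm, by rw [add_comm, mul_comm]; exact h.2⟩⟩

section
variable {K : Type*} [Field K]

/-- Two distinct points have at most one common neighbour, also when loops are counted. -/
theorem eq_of_incident_of_incident {x x' z z' : K × K} (hx : x ≠ x')
    (h₁ : x.2 + z.2 = x.1 * z.1) (h₂ : x'.2 + z.2 = x'.1 * z.1)
    (h₃ : x.2 + z'.2 = x.1 * z'.1) (h₄ : x'.2 + z'.2 = x'.1 * z'.1) : z = z' := by
  have h : (x.1 - x'.1) * (z.1 - z'.1) = 0 := by linear_combination h₂ - h₁ + h₃ - h₄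
  rcases mul_eq_zero.1 h with h | h
  · refine absurd (Prod.ext (sub_eq_zero.1 h) ?_) hx
    linear_combination h₁ - h₂ + h * z.1
  · refine Prod.ext (sub_eq_zero.1 h) ?_
    linear_combination h₁ - h₃ + h * x.1

theorem polarityGraph_cliqueFree_four : (polarityGraph K).CliqueFree 4 := by
  refine SimpleGraph.cliqueFree_iff.2 ⟨fun φ => ?_⟩
  have h : ∀ i j : Fin 4, i ≠ j → (φ i).2 + (φ j).2 = (φ i).1 * (φ j).1 := fun i j hij =>
    (φ.toHom.map_adj hij : (polarityGraph K).Adj (φ i) (φ j)).2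
  -- `φ 2` and `φ 3` are both common neighbours of `φ 0` and `φ 1`.
  have := eq_of_incident_of_incident (φ.injective.ne (by decide : (0 : Fin 4) ≠ 1))
    (h 0 2 (by decide)) (h 1 2 (by decide)) (h 0 3 (by decide)) (h 1 3 (by decide))
  exact absurd (φ.injective this) (by decide)

variable [Fintype K] [DecidableEq K]

/-- A second-moment bound: if `N z` is the number of points of `A` incident with `z`, then
`∑_z (q N z - |A|)² ≤ |A| q³`, whereas an independent set has `N z ≤ 1` at each of its own points,
the possible `1` coming from a loop. -/
theorem card_sq_le_of_isIndepSet_polarityGraph {A : Finset (K × K)}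
    (hA : (polarityGraph K).IsIndepSet (A : Set (K × K))) :
    A.card ^ 2 ≤ 4 * Fintype.card K ^ 3 := by
  set r : K × K → K × K → ℝ := fun x z => if x.2 + z.2 = x.1 * z.1 then 1 else 0 with hr
  set q : ℝ := (Fintype.card K : ℝ) with hq
  set a : ℝ := (A.card : ℝ) with ha
  have hq1 : 1 ≤ q := Nat.one_le_cast.2 (Fintype.card_pos (α := K))
  have ha0 : 0 ≤ a := Nat.cast_nonneg _
  have hdeg : ∀ x, ∑ z, r x z = q := by
    intro x
    rw [Fintype.sum_prod_type]
    have : ∀ c : K, ∑ d : K, r x (c, d) = 1 := by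
      intro c
      rw [Finset.sum_eq_single (x.1 * c - x.2)]
      · simp [hr]
      · intro d _ hd
        refine if_neg fun h => hd ?_
        linear_combination h
      · simp
    simp [this, hq]
  have hcodeg : ∀ x x', ∑ z, r x z * r x' z ≤ (if x = x' then q else 0) + 1 := by
    intro x x'
    split_ifs with h
    · subst h
      have : ∀ z, r x z * r x z = r x z := fun z => by simp [hr]
      simp [this, hdeg]
    · have : ∀ z, r x z * r x' z =
          if x.2 + z.2 = x.1 * z.1 ∧ x'.2 + z.2 = x'.1 * z.1 then 1 else 0 := fun z => by
        simp only [hr, ite_and, ite_mul, one_mul, zero_mul]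
      simp_rw [this]
      rw [Finset.sum_boole, zero_add]
      exact_mod_cast Finset.card_le_one.2 fun z hz z' hz' => by
        simp only [Finset.mem_filter, Finset.mem_univ, true_and] at hz hz'
        exact eq_of_incident_of_incident h hz.1 hz.2 hz'.1 hz'.2
  have hN1 : ∑ z, ∑ x ∈ A, r x z = a * q := by
    rw [Finset.sum_comm]
    simp [hdeg, ha]
  have hN2 : ∑ z, (∑ x ∈ A, r x z) ^ 2 ≤ a * q + a ^ 2 := by
    calc ∑ z, (∑ x ∈ A, r x z) ^ 2 = ∑ x ∈ A, ∑ x' ∈ A, ∑ z, r x z * r x' z := by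
          simp_rw [sq, Finset.sum_mul_sum]
          rw [Finset.sum_comm]
          exact Finset.sum_congr rfl fun x _ => Finset.sum_comm
      _ ≤ ∑ x ∈ A, ∑ x' ∈ A, ((if x = x' then q else 0) + 1) :=
          Finset.sum_le_sum fun x _ => Finset.sum_le_sum fun x' _ => hcodeg x x'
      _ = a * q + a ^ 2 := by
          have : ∀ x ∈ A, ∑ x' ∈ A, ((if x = x' then q else 0) + 1) = q + a := fun x hx => by
            simp [Finset.sum_add_distrib, hx, ha]
          rw [Finset.sum_congr rfl this, Finset.sum_const, nsmul_eq_mul]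
          ring
  have hvar : ∑ z, (q * ∑ x ∈ A, r x z - a) ^ 2 ≤ a * q ^ 3 := by
    have hsum : ∑ z, (q * ∑ x ∈ A, r x z - a) ^ 2 =
        q ^ 2 * ∑ z, (∑ x ∈ A, r x z) ^ 2 - 2 * q * a * ∑ z, ∑ x ∈ A, r x z + q ^ 2 * a ^ 2 := by
      have hc : q ^ 2 * a ^ 2 = ∑ _z : K × K, a ^ 2 := by
        simp only [Finset.sum_const, Finset.card_univ, Fintype.card_prod, nsmul_eq_mul,
          Nat.cast_mul, ← hq, sq]
      rw [hc, Finset.mul_sum, Finset.mul_sum, ← Finset.sum_sub_distrib, ← Finset.sum_add_distrib]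
      exact Finset.sum_congr rfl fun z _ => by ring
    rw [hsum, hN1]
    nlinarith [mul_le_mul_of_nonneg_left hN2 (sq_nonneg q)]
  have hNA : ∀ z ∈ A, ∑ x ∈ A, r x z ≤ 1 := by
    intro z hz
    rw [Finset.sum_eq_single_of_mem z hz]
    · simp only [hr]
      split_ifs <;> norm_num
    · intro x hx hxz
      exact if_neg fun h => hA hx hz hxz ⟨hxz, h⟩
  suffices h : a ^ 2 ≤ 4 * q ^ 3 by
    rw [ha, hq] at h
    exact_mod_cast h
  rcases le_or_gt a q with haq | haq
  · nlinarith [pow_le_pow_left₀ ha0 haq 2, mul_le_mul_of_nonneg_left hq1 (sq_nonneg q)]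
  · have hmain : a * (a - q) ^ 2 ≤ a * q ^ 3 := by
      calc a * (a - q) ^ 2 = ∑ z ∈ A, (a - q) ^ 2 := by simp [ha]
        _ ≤ ∑ z ∈ A, (q * ∑ x ∈ A, r x z - a) ^ 2 := by
            refine Finset.sum_le_sum fun z hz => ?_
            have := mul_le_mul_of_nonneg_left (hNA z hz) (zero_le_one.trans hq1)
            nlinarith
        _ ≤ ∑ z, (q * ∑ x ∈ A, r x z - a) ^ 2 :=
            Finset.sum_le_sum_of_subset_of_nonneg (Finset.subset_univ A) fun _ _ _ => sq_nonneg _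
        _ ≤ a * q ^ 3 := hvar
    have h := le_of_mul_le_mul_left hmain (by linarith)
    nlinarith [sq_nonneg (a - 2 * q), mul_le_mul_of_nonneg_left hq1 (sq_nonneg q)]

end

/-! ### Disjoint copies of a graph -/

section
variable {V ι W : Type*} {G : SimpleGraph V} {H : SimpleGraph W} {m : ℕ}

/-- In a disjoint union of copies of `H`, realized as the box product with the edgeless graph on the
set of copies, an independent set inside one copy is an independent set of `H`. -/
theorem card_le_of_isIndepSet_of_fst_eq (φ : G ↪g (⊥ : SimpleGraph ι) □ H)
    (hH : H.IndepSetFree (m + 1)) {s : Finset V} (hs : G.IsIndepSet (s : Set V)) {i : ι}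
    (hi : ∀ v ∈ s, (φ v).1 = i) : s.card ≤ m := by
  classical
  by_contra! hcard
  have hinj : Set.InjOn (fun v => (φ v).2) (s : Set V) := fun u hu v hv h =>
    φ.injective (Prod.ext ((hi u hu).trans (hi v hv).symm) h)
  obtain ⟨t, hts, htm⟩ := Finset.exists_subset_card_eq (Nat.succ_le_of_lt hcard)
  refine hH (t.image fun v => (φ v).2) ⟨?_, ?_⟩
  · intro u hu v hv huv hadj
    simp only [Finset.coe_image, Set.mem_image, Finset.mem_coe] at hu hv
    obtain ⟨u, hu, rfl⟩ := hu
    obtain ⟨v, hv, rfl⟩ := hv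
    refine hs (hts hu) (hts hv) (fun h => huv (by rw [h])) (φ.map_rel_iff.1 ?_)
    exact SimpleGraph.boxProd_adj.2 (Or.inr ⟨hadj, (hi u (hts hu)).trans (hi v (hts hv)).symm⟩)
  · rw [Finset.card_image_of_injOn (hinj.mono (by exact_mod_cast hts)), htm]

theorem isClawFree_of_embedding_copies (φ : G ↪g (⊥ : SimpleGraph ι) □ H)
    (hH : H.IndepSetFree (m + 1)) {k : ℕ} (hk : m < k) : IsClawFree k G := by
  classical
  rintro ⟨ψ⟩
  let s : Finset V := univ.image fun j : Fin k => ψ (Sum.inr j)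
  have hcard : s.card = k := by
    exact (Finset.card_image_of_injective _ (ψ.injective.comp Sum.inr_injective)).trans (by simp)
  refine hk.not_ge (hcard ▸ card_le_of_isIndepSet_of_fst_eq φ hH (s := s) ?_
    (i := (φ (ψ (Sum.inl 0))).1) ?_)
  · intro u hu v hv _ hadj
    simp only [s, Finset.coe_image, Set.mem_image] at hu hv
    obtain ⟨u, -, rfl⟩ := hu
    obtain ⟨v, -, rfl⟩ := hv
    simpa using ψ.map_rel_iff.1 hadj
  · intro v hv
    obtain ⟨v, -, rfl⟩ := Finset.mem_image.1 hv
    have hadj : G.Adj (ψ (Sum.inr v)) (ψ (Sum.inl 0)) := ψ.map_rel_iff.2 (by simp)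
    have := φ.map_rel_iff.2 hadj
    simp only [SimpleGraph.boxProd_adj, SimpleGraph.bot_adj, false_and, false_or] at this
    exact this.2

theorem indepNum_le_of_embedding_copies [Fintype ι] (φ : G ↪g (⊥ : SimpleGraph ι) □ H)
    (hH : H.IndepSetFree (m + 1)) [Finite V] : G.indepNum ≤ Fintype.card ι * m := by
  classical
  obtain ⟨s, hs⟩ := G.exists_isNIndepSet_indepNum
  rw [← hs.card_eq]
  by_contra! hlt
  obtain ⟨i, -, hi⟩ := Finset.exists_lt_card_fiber_of_mul_lt_card_of_maps_to
    (s := s) (t := (univ : Finset ι)) (f := fun v => (φ v).1) (n := m)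
    (fun _ _ => Finset.mem_univ _) (by simpa using hlt)
  refine hi.not_ge (card_le_of_isIndepSet_of_fst_eq φ hH (i := i) ?_ fun v hv =>
    (Finset.mem_filter.1 hv).2)
  exact Set.Pairwise.mono (Finset.coe_subset.2 (Finset.filter_subset _ s)) hs.isIndepSet

theorem card_le_indepNum_of_iso_copies [Fintype ι] [Finite V] [Nonempty W]
    (φ : G ≃g (⊥ : SimpleGraph ι) □ H) : Fintype.card ι ≤ G.indepNum := by
  classical
  obtain ⟨w⟩ := ‹Nonempty W›
  have hinj : Function.Injective fun i : ι => φ.symm (i, w) := fun i j h => by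
    simpa using φ.symm.injective h
  rw [← Finset.card_univ, ← Finset.card_image_of_injective _ hinj]
  refine SimpleGraph.IsIndepSet.card_le_indepNum ?_
  intro u hu v hv _ hadj
  simp only [Finset.coe_image, Set.mem_image] at hu hv
  obtain ⟨u, -, rfl⟩ := hu
  obtain ⟨v, -, rfl⟩ := hv
  simpa using φ.symm.map_rel_iff.1 hadj

/-- A clique of a disjoint union of copies of `H` lies in one copy. -/
theorem exists_isClique_card_eq_of_embedding_copies (φ : G ↪g (⊥ : SimpleGraph ι) □ H)
    {Q : Finset V} (hQ : G.IsClique (Q : Set V)) :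
    ∃ R : Finset W, H.IsClique (R : Set W) ∧ R.card = Q.card := by
  classical
  have key : ∀ u ∈ Q, ∀ v ∈ Q, u ≠ v → H.Adj (φ u).2 (φ v).2 := by
    intro u hu v hv huv
    have := φ.map_rel_iff.2 (hQ hu hv huv)
    simp only [SimpleGraph.boxProd_adj, SimpleGraph.bot_adj, false_and, false_or] at this
    exact this.1
  refine ⟨Q.image fun v => (φ v).2, ?_, Finset.card_image_of_injOn fun u hu v hv h => ?_⟩
  · intro u hu v hv huv
    simp only [Finset.coe_image, Set.mem_image, Finset.mem_coe] at hu hv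
    obtain ⟨u, hu, rfl⟩ := hu
    obtain ⟨v, hv, rfl⟩ := hv
    exact key u hu v hv fun h => huv (by rw [h])
  · by_contra huv
    exact (key u hu v hv huv).ne h

end

/-! ### The integrality gap -/

/-- For `k ≥ 4` and `F > 0`, the disjoint union of `k` copies of the complement of the polarity
graph over a large prime field has level-`⌈N / F⌉` gap at least `F / (9 k)`: its cliques have at most
`N / F` vertices, so that weight `F / (3 N)` on each singleton is feasible. -/
theorem exists_isClawFree_div_le_saIntegralityGap {k : ℕ} (hk : 4 ≤ k) {F : ℝ} (hF : 0 < F)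
    (M : ℕ) :
    ∃ N : ℕ, M < N ∧ ∃ G : SimpleGraph (Fin N), IsClawFree k G ∧ k ≤ G.indepNum ∧
      F / (9 * k) ≤ saIntegralityGap G ⌈(N : ℝ) / F⌉₊ := by
  obtain ⟨p, hpge, hp⟩ := Nat.exists_infinite_primes (M + 1 + ⌈4 * F ^ 2⌉₊ + ⌈F⌉₊)
  have : Fact p.Prime := ⟨hp⟩
  have hpF2 : 4 * F ^ 2 ≤ p := (Nat.le_ceil _).trans (by exact_mod_cast (by omega))
  have hpF : F ≤ p := (Nat.le_ceil _).trans (by exact_mod_cast (by omega))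
  have hp1 : (1 : ℝ) ≤ p := by exact_mod_cast hp.one_le
  have hk1 : (1 : ℝ) ≤ k := by exact_mod_cast (by omega : 1 ≤ k)
  set H : SimpleGraph (ZMod p × ZMod p) := (polarityGraph (ZMod p))ᶜ with hHdef
  have hH : H.IndepSetFree (3 + 1) := by
    rw [← SimpleGraph.cliqueFree_compl, hHdef, compl_compl]
    exact polarityGraph_cliqueFree_four
  have hcardV : Fintype.card (Fin k × ZMod p × ZMod p) = k * p ^ 2 := by
    simp [ZMod.card, sq]
  set N : ℕ := k * p ^ 2 with hN
  let G : SimpleGraph (Fin N) := ((⊥ : SimpleGraph (Fin k)) □ H).overFin hcardV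
  let φ : G ≃g (⊥ : SimpleGraph (Fin k)) □ H :=
    (((⊥ : SimpleGraph (Fin k)) □ H).overFinIso hcardV).symm
  have hNR : (N : ℝ) = k * (p : ℝ) ^ 2 := by simp [hN]
  have hpN : (p : ℝ) ≤ N := by
    rw [hNR]
    nlinarith [mul_le_mul_of_nonneg_left hp1 (zero_le_one.trans hp1),
      mul_le_mul_of_nonneg_right hk1 (sq_nonneg (p : ℝ))]
  have hNpos : (0 : ℝ) < N := by linarith
  have hclique : ∀ Q : Finset (Fin N), G.IsClique (Q : Set (Fin N)) → (Q.card : ℝ) ≤ N / F := by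
    intro Q hQ
    obtain ⟨R, hR, hRQ⟩ := exists_isClique_card_eq_of_embedding_copies φ.toEmbedding hQ
    have h := card_sq_le_of_isIndepSet_polarityGraph ((SimpleGraph.isClique_compl _).1 hR)
    rw [hRQ, ZMod.card] at h
    have hR' : (Q.card : ℝ) ^ 2 ≤ 4 * (p : ℝ) ^ 3 := by exact_mod_cast h
    rw [le_div_iff₀ hF]
    refine le_of_sq_le_sq ?_ hNpos.le
    calc ((Q.card : ℝ) * F) ^ 2 = (Q.card : ℝ) ^ 2 * F ^ 2 := by ring
      _ ≤ 4 * (p : ℝ) ^ 3 * F ^ 2 := by gcongr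
      _ = (p : ℝ) ^ 3 * (4 * F ^ 2) := by ring
      _ ≤ (p : ℝ) ^ 3 * p := by gcongr
      _ = 1 * (p : ℝ) ^ 4 := by ring
      _ ≤ (k : ℝ) ^ 2 * (p : ℝ) ^ 4 := by
          gcongr
          exact one_le_pow₀ hk1
      _ = (N : ℝ) ^ 2 := by rw [hNR]; ring
  have hℓ : (⌈(N : ℝ) / F⌉₊ : ℝ) ≤ 2 * (N / F) := by
    have h1 : 1 ≤ (N : ℝ) / F := (one_le_div hF).2 (hpF.trans hpN)
    linarith [(Nat.ceil_lt_add_one (by positivity : 0 ≤ (N : ℝ) / F)).le]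
  have hgap := mul_card_div_indepNum_le_saIntegralityGap G ⌈(N : ℝ) / F⌉₊
    (x := F / (3 * N)) (by positivity) fun Q hQ => by
      calc ((⌈(N : ℝ) / F⌉₊ : ℝ) + Q.card) * (F / (3 * N))
          ≤ (2 * (N / F) + N / F) * (F / (3 * N)) := by
            gcongr
            exact hclique Q hQ
        _ = 1 := by field_simp; norm_num
  have hle : G.indepNum ≤ k * 3 := by
    simpa using indepNum_le_of_embedding_copies φ.toEmbedding hH
  have hge : k ≤ G.indepNum := by
    simpa using card_le_indepNum_of_iso_copies φ
  refine ⟨N, ?_, G, isClawFree_of_embedding_copies φ.toEmbedding hH (by omega), hge, le_trans ?_ hgap⟩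
  · have h : p ≤ N := by exact_mod_cast hpN
    omega
  · have hval : (Fintype.card (Fin N) : ℝ) * (F / (3 * N)) = F / 3 := by
      rw [Fintype.card_fin]
      field_simp
    have hα : (0 : ℝ) < G.indepNum := by exact_mod_cast (by omega : 0 < G.indepNum)
    have hle' : (G.indepNum : ℝ) ≤ k * 3 := by exact_mod_cast hle
    rw [hval, div_div]
    exact div_le_div_of_nonneg_left hF.le (by positivity) (by linarith)

theorem theorem7 :
    ∃ c₁ c₂ c₃ c₄ : ℝ, 0 < c₁ ∧ 0 < c₂ ∧ 0 < c₃ ∧ 0 < c₄ ∧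
      ∀ f : ℕ → ℝ, (∃ a : ℝ, 0 < a ∧ ∀ k : ℕ, 4 ≤ k → a * (k : ℝ) ^ 3 ≤ f k) →
        ∀ k : ℕ, 4 ≤ k →
          {n : ℕ | ∃ (N : ℕ) (G : SimpleGraph (Fin N)),
            c₁ * (n : ℝ) ≤ (N : ℝ) ∧ (N : ℝ) ≤ c₂ * (n : ℝ) ∧
            IsClawFree k G ∧ k ≤ G.indepNum ∧
            ∃ ℓ : ℕ, 1 ≤ ℓ ∧ c₃ * ((n : ℝ) / f k) ≤ (ℓ : ℝ) ∧
              c₄ * (f k / (k : ℝ) ^ 2) ≤ saIntegralityGap G ℓ}.Infinite := by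
  refine ⟨1, 1, 1, 1 / 9, one_pos, one_pos, one_pos, by norm_num, ?_⟩
  rintro f ⟨a, ha, hf⟩ k hk
  have hk1 : (1 : ℝ) ≤ k := by exact_mod_cast (by omega : 1 ≤ k)
  have hF : 0 < f k := (by positivity : 0 < a * (k : ℝ) ^ 3).trans_le (hf k hk)
  refine Set.infinite_of_forall_exists_gt fun M => ?_
  obtain ⟨N, hMN, G, hclaw, hα, hgap⟩ := exists_isClawFree_div_le_saIntegralityGap hk hF M
  have hN : (0 : ℝ) < N := by exact_mod_cast (by omega : 0 < N)
  refine ⟨N, ⟨N, G, by simp, by simp, hclaw, hα, ⌈(N : ℝ) / f k⌉₊, ?_, ?_, ?_⟩, hMN⟩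
  · exact Nat.one_le_iff_ne_zero.2 (Nat.ceil_pos.2 (by positivity)).ne'
  · simpa using Nat.le_ceil ((N : ℝ) / f k)
  · refine le_trans ?_ hgap
    rw [div_mul_div_comm, one_mul]
    gcongr
    exact le_self_pow₀ hk1 two_ne_zero
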